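/- Let $n \ge 0$, let $p$ be a prime, and let $k \in \mathbb{N}$ satisfy $p^k > 2^{2n}$. Let $\tilde{\mathbb{F}}$ be a field of size $p^{2k}$ and let $\mathbb{F} \subseteq \tilde{\mathbb{F}}$ be its subfield of size $p^k$. Then $\tilde{\mathbb{F}} \setminus \mathbb{F}$ is non-empty, and for every $\beta \in \tilde{\mathbb{F}} \setminus \mathbb{F}$ there exists $\alpha = (\alpha_1, \dots, \alpha_n) \in \mathbb{F}^n$ such that, for $$f(\mathbf{x}, \mathbf{y}) = \sum_{i=1}^n \alpha_i x_i y_i - \beta \in \tilde{\mathbb{F}}[x_1, \dots, x_n, y_1, \dots, y_n],$$ the following hold. 1. $f$ has no zero on the Boolean cube $\{0,1\}^{2n}$. 2. If $g \in \tilde{\mathbb{F}}[\mathbf{x}, \mathbf{y}]$ agrees with $1/f$ on $\{0,1\}^{2n}$, then every roABP over $\tilde{\mathbb{F}}$ that computes $g$ in a variable order in which all $\mathbf{x}$ variables precede all $\mathbf{y}$ variables has width at least $2^n$. 3. Every $\mathrm{roABP}$-$\mathrm{IPS}_{\mathrm{LIN}'}$ refutation of $f$ over $\tilde{\mathbb{F}}$,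 in a variable order in which all $\mathbf{x}$ variables precede all $\mathbf{y}$ variables (the placeholder variables may occur anywhere in the order), has width at least $2^n$. Here an roABP (read-once oblivious algebraic branching program) in $N$ variables $v_1, \dots, v_N$ in the order $\pi \in \mathcal{S}_N$ is a layered directed graph with layers $V_0 = \{s\}, V_1, \dots, V_N = \{t\}$, in which the edges from $V_{i-1}$ to $V_i$ are labelled by univariate polynomials in $v_{\pi(i)}$. It computes the sum, over all $s$-to-$t$ paths, of the product of the edge labels on the path; its width is $\max_i |V_i|$. An $\mathrm{roABP}$-$\mathrm{IPS}_{\mathrm{LIN}'}$ refutation of $f$ is an roABP in the $4n+1$ variables consisting of the variables $\mathbf{w} = (\mathbf{x}, \mathbf{y})$ and placeholders $u$ and $\mathbf{z} = (z_1, \dots, z_{2n})$, whose computed polynomial $C(\mathbf{w}, u, \mathbf{z})$ has degree at most $1$ in $u$ and satisfies $$C(\mathbf{w}, 0, \mathbf{0}) = 0 \quad\text{and}\quad C(\mathbf{w}, f, w_1^2 - w_1, \dots, w_{2n}^2 - w_{2n}) = 1.$$ -/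

import Mathlib

/-- A read-once oblivious algebraic branching program over `K` in the variables `σ`.
The variable order is `order`, so `order i` is the variable read between layers `i` and `i + 1`.
Layer `j` has the `size j` vertices `Fin (size j)`; the first layer is `{s}` and the last is `{t}`.
The edge from `u` to `v` is labelled by the univariate polynomial `label i u v`;
a missing edge is an edge with label `0`. -/
structure ROABP (K σ : Type*) [CommSemiring K] where
  length : ℕ
  order : Fin length ≃ σ
  size : Fin (length + 1) → ℕ
  size_first : size 0 = 1
  size_last : size (Fin.last length) = 1
  label : (i : Fin length) → Fin (size i.castSucc) → Fin (size i.succ) → Polynomial K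

namespace ROABP

variable {K σ : Type*} [CommSemiring K]

/-- The polynomial computed by the program: the sum over all `s`-to-`t` paths (one vertex in each
layer) of the product of the edge labels along the path. -/
noncomputable def poly (B : ROABP K σ) : MvPolynomial σ K :=
  ∑ path : ((j : Fin (B.length + 1)) → Fin (B.size j)), ∏ i : Fin B.length,
    Polynomial.aeval (MvPolynomial.X (B.order i) : MvPolynomial σ K)
      (B.label i (path i.castSucc) (path i.succ))

/-- The size of the largest layer. -/
def width (B : ROABP K σ) : ℕ := Finset.univ.sup B.size

/-- Every variable `u i` is read before every variable `v j`. -/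
def ReadsBefore {ι κ : Type*} (B : ROABP K σ) (u : ι → σ) (v : κ → σ) : Prop :=
  ∀ i j, B.order.symm (u i) < B.order.symm (v j)

end ROABP

/-- The variables of an Ideal Proof System refutation of a system of polynomial equations indexed
by `ι` in the variables `σ`: the original variables, one placeholder for each equation, and one
placeholder for each Boolean axiom. -/
inductive IPSVar (σ ι : Type*) where
  | orig : σ → IPSVar σ ι
  | eqn : ι → IPSVar σ ι
  | bool : σ → IPSVar σ ι

namespace IPSVar

variable {K σ ι : Type*} [CommRing K]

/-- Substitute `0` for all placeholders. -/
noncomputable def substZero : IPSVar σ ι → MvPolynomial σ K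
  | orig i => MvPolynomial.X i
  | eqn _ => 0
  | bool _ => 0

/-- Substitute the equation `f j` and the Boolean axiom `x_i ^ 2 - x_i` for the placeholders. -/
noncomputable def substAxioms (f : ι → MvPolynomial σ K) : IPSVar σ ι → MvPolynomial σ K
  | orig i => MvPolynomial.X i
  | eqn j => f j
  | bool i => MvPolynomial.X i ^ 2 - MvPolynomial.X i

end IPSVar

/-- `C` is an Ideal Proof System refutation of the system `f` (over the Boolean cube). -/
def IsIPSRefutation {K σ ι : Type*} [CommRing K] (f : ι → MvPolynomial σ K)
    (C : MvPolynomial (IPSVar σ ι) K) : Prop :=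
  MvPolynomial.bind₁ IPSVar.substZero C = 0 ∧
    MvPolynomial.bind₁ (IPSVar.substAxioms f) C = 1

/-- The refutation `C` has individual degree at most one in the placeholders of the equations
(and any degree in the placeholders of the Boolean axioms). -/
def IsIPSLinPrimeRefutation {K σ ι : Type*} [CommRing K] (f : ι → MvPolynomial σ K)
    (C : MvPolynomial (IPSVar σ ι) K) : Prop :=
  IsIPSRefutation f C ∧ ∀ j, C.degreeOf (IPSVar.eqn j) ≤ 1

/-- The point `a` lies on the Boolean cube. -/
def IsBooleanPoint {K σ : Type*} [Zero K] [One K] (a : σ → K) : Prop :=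
  ∀ i, a i = 0 ∨ a i = 1

/-- The polynomial `∑ i, α i * x i * y i - β`, where `x i` is the variable `Sum.inl i` and `y i` is
the variable `Sum.inr i`. -/
noncomputable def liftedSubsetSum {K : Type*} [CommRing K] {n : ℕ} (α : Fin n → K) (β : K) :
    MvPolynomial (Fin n ⊕ Fin n) K :=
  ∑ i, MvPolynomial.C (α i) * MvPolynomial.X (Sum.inl i) * MvPolynomial.X (Sum.inr i)
    - MvPolynomial.C β

/-! At the Boolean point with indicators of `S` and `T`, `1 / f` equals `h (S ∩ T)`, where `h W = 1
/ (∑ i ∈ W, α i - β)`. Möbius inversion on subsets makes this `2 ^ n` by `2 ^ n` matrix invertible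
once every alternating sum of `h` over the subsets of a set `U` is nonzero.

Such `α` is chosen one coordinate at a time. A new coordinate `x` turns an old alternating sum `A ≠
0` into `A` minus the same sum with denominators shifted by `x`. The shifted sum is a proper
rational function of `x`, so it equals `A` at few `x`, and `F` is large enough to avoid these for
all `U` at once.

Cutting an roABP between the two blocks of variables factors the matrix through one layer, so the
width is at least the rank. For a refutation, linearity in `u` gives `C(w, 1, 0) = 1 / f` on the
cube, and fixing the placeholders to constants does not affect the cut. -/

/-! ### Choice of the coefficients -/

open Finset in
/-- The bad points of a partial fraction identity with nonzero constant are the zeros of a nonzero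
polynomial. -/
theorem exists_finset_card_le_of_eq_sum_div {K κ : Type*} [Field K] [DecidableEq κ]
    (t : Finset κ) (c e : κ → K) {A : K} (hA : A ≠ 0) :
    ∃ Z : Finset K, #Z ≤ #t ∧
      ∀ x, (∀ w ∈ t, c w + x ≠ 0) → A = ∑ w ∈ t, e w / (c w + x) → x ∈ Z := by
  classical
  let Q : Finset κ → Polynomial K := fun s => ∏ w ∈ s, (Polynomial.X + Polynomial.C (c w))
  have hQm : ∀ s, (Q s).Monic := fun s =>
    Polynomial.monic_prod_of_monic _ _ fun w _ => Polynomial.monic_X_add_C _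
  have hQd : ∀ s, (Q s).natDegree = #s := fun s => by
    simp only [Q]
    rw [Polynomial.natDegree_prod_of_monic _ _ fun w _ => Polynomial.monic_X_add_C _]
    simp
  -- Clearing denominators: each subtracted product lacks one factor, so the top coefficient remains
  -- `A`.
  let P : Polynomial K := Polynomial.C A * Q t - ∑ w ∈ t, Polynomial.C (e w) * Q (t.erase w)
  have hcoeff : P.coeff #t = A := by
    have h1 : (Q t).coeff #t = 1 := by
      have := hQm t
      rwa [Polynomial.Monic, Polynomial.leadingCoeff, hQd] at this
    have h2 : ∀ w ∈ t, (Q (t.erase w)).coeff #t = 0 := fun w hw =>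
      Polynomial.coeff_eq_zero_of_natDegree_lt (by rw [hQd]; exact card_erase_lt_of_mem hw)
    simp only [P, Polynomial.coeff_sub, Polynomial.coeff_C_mul, Polynomial.finsetSum_coeff, h1]
    rw [sum_eq_zero fun w hw => by rw [h2 w hw, mul_zero]]
    simp
  have hP : P ≠ 0 := fun h => hA (by rw [← hcoeff, h, Polynomial.coeff_zero])
  have hdeg : P.natDegree ≤ #t := by
    refine (Polynomial.natDegree_sub_le _ _).trans (max_le ?_ ?_)
    · exact (Polynomial.natDegree_C_mul_le _ _).trans (hQd t).le
    · refine Polynomial.natDegree_sum_le_of_forall_le _ _ fun w _ => ?_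
      exact (Polynomial.natDegree_C_mul_le _ _).trans
        ((hQd _).le.trans (card_le_card (erase_subset _ _)))
  refine ⟨P.roots.toFinset, ?_, fun x hx hAx => ?_⟩
  · exact (Multiset.toFinset_card_le _).trans ((Polynomial.card_roots' P).trans hdeg)
  · rw [Multiset.mem_toFinset, Polynomial.mem_roots hP, Polynomial.IsRoot]
    have hQe : ∀ s, (Q s).eval x = ∏ w ∈ s, (c w + x) := fun s => by
      simp [Q, Polynomial.eval_prod, add_comm]
    simp only [P, Polynomial.eval_sub, Polynomial.eval_mul, Polynomial.eval_C,
      Polynomial.eval_finsetSum, hQe]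
    rw [hAx, sum_mul, sub_eq_zero]
    refine sum_congr rfl fun w hw => ?_
    rw [← mul_prod_erase t _ hw, ← mul_assoc, div_mul_cancel₀ _ (hx w hw)]

open Finset in
/-- Outside a proper subfield containing more than `4 ^ #s` elements, the alternating sums of the
inverted shifted subset sums can be made nonzero. -/
theorem exists_forall_alternating_sum_ne_zero {K ι : Type*} [Field K] [DecidableEq ι]
    (F : Subfield K) {β : K} (hβ : β ∉ F) (s : Finset ι) (hs : 2 ^ (2 * #s) < Nat.card F) :
    ∃ α : ι → F, ∀ U ⊆ s,
      ∑ W ∈ U.powerset, (-1 : K) ^ #W * (1 / (∑ i ∈ W, (α i : K) - β)) ≠ 0 := by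
  classical
  induction s using Finset.induction_on with
  | empty =>
    refine ⟨0, fun U hU => ?_⟩
    have : β ≠ 0 := fun h => hβ (h ▸ F.zero_mem)
    simpa [subset_empty.1 hU] using this
  | insert a s ha ih =>
    rw [card_insert_of_notMem ha] at hs
    obtain ⟨α, hα⟩ := ih (lt_of_le_of_lt (Nat.pow_le_pow_right (by lia) (by lia)) hs)
    have key : ∀ U : Finset ι, ∃ Z : Finset K, #Z ≤ 2 ^ #s ∧ (U ⊆ s → ∀ x,
        (∀ W ∈ U.powerset, (∑ i ∈ W, (α i : K) - β) + x ≠ 0) →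
        ∑ W ∈ U.powerset, (-1 : K) ^ #W * (1 / (∑ i ∈ W, (α i : K) - β)) =
          ∑ W ∈ U.powerset, (-1 : K) ^ #W / (∑ i ∈ W, (α i : K) - β + x) → x ∈ Z) := by
      intro U
      by_cases hU : U ⊆ s
      · obtain ⟨Z, hZ, h⟩ := exists_finset_card_le_of_eq_sum_div U.powerset
          (fun W => ∑ i ∈ W, (α i : K) - β) (fun W => (-1 : K) ^ #W) (hα U hU)
        refine ⟨Z, hZ.trans ?_, fun _ => h⟩
        rw [card_powerset]
        exact Nat.pow_le_pow_right (by lia) (card_le_card hU)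
      · exact ⟨∅, by simp, fun h => absurd h hU⟩
    choose Z hZ hZm using key
    -- There are `2 ^ #s` bad sets of size at most `2 ^ #s`, hence fewer bad points than elements of
    -- `F`.
    obtain ⟨x, hxF, hx⟩ : ∃ x ∈ (F : Set K), x ∉ ((s.powerset.biUnion Z : Finset K) : Set K) := by
      refine Set.exists_mem_notMem_of_ncard_lt_ncard ?_ (Finset.finite_toSet _)
      rw [Set.ncard_coe_finset]
      refine lt_of_le_of_lt (card_biUnion_le_card_mul _ _ _ fun U _ => hZ U) ?_
      rw [card_powerset, ← pow_add]
      exact lt_of_le_of_lt (Nat.pow_le_pow_right (by lia) (by lia)) hs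
    refine ⟨Function.update α a ⟨x, hxF⟩, fun U hU => ?_⟩
    have hsum : ∀ W, a ∉ W → ∑ i ∈ W, ((Function.update α a ⟨x, hxF⟩ i : F) : K) =
        ∑ i ∈ W, (α i : K) := fun W hW => sum_congr rfl fun i hi => by
      rw [Function.update_of_ne fun h : i = a => hW (h ▸ hi)]
    have hold : ∀ V : Finset ι, a ∉ V → ∑ W ∈ V.powerset, (-1 : K) ^ #W *
        (1 / (∑ i ∈ W, ((Function.update α a ⟨x, hxF⟩ i : F) : K) - β)) =
        ∑ W ∈ V.powerset, (-1 : K) ^ #W * (1 / (∑ i ∈ W, (α i : K) - β)) := fun V hV =>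
      sum_congr rfl fun W hW => by rw [hsum W fun h => hV (mem_powerset.1 hW h)]
    by_cases haU : a ∈ U
    · obtain ⟨V, haV, rfl⟩ : ∃ V, a ∉ V ∧ insert a V = U :=
        ⟨U.erase a, notMem_erase _ _, insert_erase haU⟩
      have hVs : V ⊆ s := fun i hi =>
        (mem_insert.1 (hU (mem_insert_of_mem hi))).resolve_left fun h => haV (h ▸ hi)
      rw [sum_powerset_insert haV, hold V haV]
      intro h0
      refine hx (mem_coe.2 (mem_biUnion.2 ⟨V, mem_powerset.2 hVs, hZm V hVs x ?_ ?_⟩))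
      -- A vanishing denominator would put `β` in `F`.
      · intro W _ h
        refine hβ ?_
        have : β = ∑ i ∈ W, (α i : K) + x := by linear_combination -h
        rw [this]
        exact F.add_mem (F.sum_mem fun i _ => (α i).2) hxF
      · rw [eq_neg_of_add_eq_zero_left h0, ← sum_neg_distrib]
        refine sum_congr rfl fun W hW => ?_
        have haW : a ∉ W := fun h => haV (mem_powerset.1 hW h)
        rw [card_insert_of_notMem haW, sum_insert haW, hsum W haW, Function.update_self, pow_succ,
          show x + ∑ i ∈ W, (α i : K) - β = ∑ i ∈ W, (α i : K) - β + x by ring]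
        ring
    · rw [hold U haU]
      exact hα U fun i hi => (mem_insert.1 (hU hi)).resolve_left fun h => haU (h ▸ hi)

/-! ### Intersection matrices -/

open Finset in
/-- Möbius row reduction of an intersection matrix. -/
theorem sum_powerset_neg_one_pow_mul_inter {K ι : Type*} [CommRing K] [DecidableEq ι]
    (h : Finset ι → K) (S T : Finset ι) :
    ∑ W ∈ S.powerset, (-1 : K) ^ #W * h (W ∩ T) =
      if S ⊆ T then ∑ W ∈ S.powerset, (-1 : K) ^ #W * h W else 0 := by
  split_ifs with hST
  · refine sum_congr rfl fun W hW => ?_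
    rw [inter_eq_left.2 ((mem_powerset.1 hW).trans hST)]
  · obtain ⟨a, haS, haT⟩ := not_subset.1 hST
    -- Since `a ∉ T`, the terms of `W` and `insert a W` cancel.
    rw [← insert_erase haS, sum_powerset_insert (notMem_erase a S), ← sum_add_distrib]
    refine sum_eq_zero fun W hW => ?_
    have haW : a ∉ W := fun h => notMem_erase a S (mem_powerset.1 hW h)
    rw [insert_inter_of_notMem haT, card_insert_of_notMem haW, pow_succ]
    ring

open Finset in
/-- An intersection matrix all of whose Möbius coefficients are nonzero is invertible. -/
theorem isUnit_intersection_matrix {K ι : Type*} [Field K] [Fintype ι] [DecidableEq ι]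
    (h : Finset ι → K) (hh : ∀ U : Finset ι, ∑ W ∈ U.powerset, (-1 : K) ^ #W * h W ≠ 0) :
    IsUnit (Matrix.of fun S T : Finset ι => h (S ∩ T)) := by
  rw [← Matrix.mulVec_injective_iff_isUnit]
  refine (injective_iff_map_eq_zero (Matrix.mulVecLin _)).2 fun v hv => ?_
  have hrow : ∀ S, ∑ T, h (S ∩ T) * v T = 0 := fun S => congrFun hv S
  have hup : ∀ S : Finset ι, ∑ T, (if S ⊆ T then v T else 0) = 0 := by
    intro S
    refine (mul_eq_zero.1 ?_).resolve_left (hh S)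
    calc (∑ W ∈ S.powerset, (-1 : K) ^ #W * h W) * ∑ T, (if S ⊆ T then v T else 0)
        = ∑ T, (∑ W ∈ S.powerset, (-1 : K) ^ #W * h (W ∩ T)) * v T := by
          rw [mul_sum]
          refine sum_congr rfl fun T _ => ?_
          rw [sum_powerset_neg_one_pow_mul_inter]
          split_ifs <;> simp
      _ = ∑ W ∈ S.powerset, (-1 : K) ^ #W * ∑ T, h (W ∩ T) * v T := by
          simp only [sum_mul, mul_sum, mul_assoc]
          exact sum_comm
      _ = 0 := sum_eq_zero fun W _ => by rw [hrow, mul_zero]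
  funext S
  -- Back substitution from large sets down: in `hup S` all terms but `v S` are already zero.
  induction S using WellFoundedGT.induction with
  | ind S ih =>
    rw [Pi.zero_apply, ← hup S, sum_eq_single S]
    · simp
    · intro T _ hT
      split_ifs with hST
      · exact ih T (lt_of_le_of_ne hST (Ne.symm hT))
      · rfl
    · simp

/-! ### Width and rank -/

namespace ROABP

theorem eval_poly {K σ : Type*} [CommSemiring K] (B : ROABP K σ) (a : σ → K) :
    MvPolynomial.eval a B.poly =
      ∑ path : ((j : Fin (B.length + 1)) → Fin (B.size j)), ∏ i : Fin B.length,
        (B.label i (path i.castSucc) (path i.succ)).eval (a (B.order i)) := by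
  simp only [poly, map_sum, map_prod]
  refine Finset.sum_congr rfl fun path _ => Finset.prod_congr rfl fun i _ => ?_
  rw [← MvPolynomial.coe_aeval_eq_eval, RingHom.coe_coe, ← Polynomial.aeval_algHom_apply,
    MvPolynomial.aeval_X, Polynomial.coe_aeval_eq_eval]

/-- Cutting a program at layer `m` factors its evaluations through that layer. -/
theorem exists_eval_poly_eq_mul {K σ S T : Type*} [CommSemiring K] (B : ROABP K σ)
    (m : Fin (B.length + 1)) (pt : S → T → σ → K)
    (hleft : ∀ i : Fin B.length, i.castSucc < m → ∀ s t t', pt s t (B.order i) = pt s t' (B.order i))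
    (hright : ∀ i : Fin B.length, m ≤ i.castSucc →
      ∀ s s' t, pt s t (B.order i) = pt s' t (B.order i)) :
    ∃ (L : Matrix S (Fin (B.size m)) K) (R : Matrix (Fin (B.size m)) T K),
      (Matrix.of fun s t => MvPolynomial.eval (pt s t) B.poly) = L * R := by
  classical
  rcases isEmpty_or_nonempty T with hT | ⟨⟨t₀⟩⟩
  · exact ⟨0, 0, by ext s t; exact hT.elim t⟩
  rcases isEmpty_or_nonempty S with hS | ⟨⟨s₀⟩⟩
  · exact ⟨0, 0, by ext s t; exact hS.elim s⟩
  -- Split each path after layer `m`; the right part sees the left one only through its vertex in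
  -- layer `m`.
  let e := Equiv.piEquivPiSubtypeProd (fun j => j ≤ m) (fun j => Fin (B.size j))
  let A : S → ((j : {j // j ≤ m}) → Fin (B.size j)) → K := fun s l => ∏ i : Fin B.length,
    if h : i.castSucc < m then
      (B.label i (l ⟨i.castSucc, h.le⟩) (l ⟨i.succ, Fin.castSucc_lt_iff_succ_le.1 h⟩)).eval
        (pt s t₀ (B.order i))
    else 1
  let G : T → ((j : {j // j ≤ m}) → Fin (B.size j)) → K := fun t l => ∑ r, ∏ i : Fin B.length,
    if i.castSucc < m then 1 else
      (B.label i (e.symm (l, r) i.castSucc) (e.symm (l, r) i.succ)).eval (pt s₀ t (B.order i))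
  let ev : ((j : {j // j ≤ m}) → Fin (B.size j)) → Fin (B.size m) := fun l => l ⟨m, le_rfl⟩
  have hG : ∀ t, (G t).FactorsThrough ev := by
    intro t l l' hl
    have hmem : ∀ r, ∀ j, m ≤ j → e.symm (l, r) j = e.symm (l', r) j := by
      intro r j hj
      rcases hj.eq_or_lt with rfl | hj
      · simpa [e, Equiv.piEquivPiSubtypeProd] using hl
      · simp [e, Equiv.piEquivPiSubtypeProd, not_le.2 hj]
    refine Finset.sum_congr rfl fun r _ => Finset.prod_congr rfl fun i _ => ?_
    split_ifs with h
    · rfl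
    · rw [hmem r _ (not_lt.1 h), hmem r _ ((not_lt.1 h).trans i.castSucc_lt_succ.le)]
  -- The default `0` is harmless: a vertex `v` on no left half has a zero column in the left factor.
  refine ⟨Matrix.of fun s v => ∑ l with ev l = v, A s l,
    Matrix.of fun v t => Function.extend ev (G t) 0 v, ?_⟩
  ext s t
  simp only [Matrix.of_apply, Matrix.mul_apply, eval_poly]
  calc _ = ∑ l, A s l * G t l := by
        rw [← e.symm.sum_comp, Fintype.sum_prod_type]
        refine Finset.sum_congr rfl fun l _ => ?_
        rw [Finset.mul_sum]
        refine Finset.sum_congr rfl fun r _ => ?_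
        rw [← Finset.prod_mul_distrib]
        refine Finset.prod_congr rfl fun i _ => ?_
        have hmem : ∀ j, ∀ hj : j ≤ m, e.symm (l, r) j = l ⟨j, hj⟩ := fun j hj => by
          simp [e, Equiv.piEquivPiSubtypeProd, hj]
        split_ifs with h
        · rw [hmem _ h.le, hmem _ (Fin.castSucc_lt_iff_succ_le.1 h), hleft i h s t t₀, mul_one]
        · rw [hright i (not_lt.1 h) s s₀ t, one_mul]
    _ = ∑ v, ∑ l with ev l = v, A s l * G t l := (Finset.sum_fiberwise _ _ _).symm
    _ = _ := by
        refine Finset.sum_congr rfl fun v _ => ?_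
        rw [Finset.sum_mul]
        refine Finset.sum_congr rfl fun l hl => ?_
        rw [← (Finset.mem_filter.1 hl).2, (hG t).extend_apply]

/-- A program reading the variables `u` before the variables `v` has width at least the size of any
invertible matrix of evaluations whose rows fix the `u`, whose columns fix the `v`, and whose other
variables are constant. -/
theorem card_le_width_of_isUnit {K σ ι κ S : Type*} [Field K] [Fintype ι] [Fintype S]
    [DecidableEq S] (B : ROABP K σ) {u : ι → σ} {v : κ → σ} (hB : B.ReadsBefore u v)
    (pt : S → S → σ → K)
    (hu : ∀ x, x ∉ Set.range u → ∀ s s' t, pt s t x = pt s' t x)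
    (hv : ∀ x, x ∉ Set.range v → ∀ s t t', pt s t x = pt s t' x)
    (hunit : IsUnit (Matrix.of fun s t => MvPolynomial.eval (pt s t) B.poly)) :
    Fintype.card S ≤ B.width := by
  -- The layer right after the last `u` variable is read, or layer `0` if there is none.
  let m : Fin (B.length + 1) := Finset.univ.sup fun i => (B.order.symm (u i)).succ
  have hum : ∀ i, (B.order.symm (u i)).castSucc < m := fun i =>
    Fin.castSucc_lt_iff_succ_le.2
      (Finset.le_sup (f := fun i => (B.order.symm (u i)).succ) (Finset.mem_univ i))
  have hvm : ∀ j, m ≤ (B.order.symm (v j)).castSucc := fun j =>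
    Finset.sup_le fun i _ => Fin.castSucc_lt_iff_succ_le.1 (Fin.castSucc_lt_castSucc_iff.2 (hB i j))
  obtain ⟨L, R, hLR⟩ := B.exists_eval_poly_eq_mul m pt
    (fun i hi s t t' => hv _ (by
      rintro ⟨j, hj⟩
      have := hvm j
      rw [hj, Equiv.symm_apply_apply] at this
      exact absurd hi (not_lt.2 this)) s t t')
    (fun i hi s s' t => hu _ (by
      rintro ⟨j, hj⟩
      have := hum j
      rw [hj, Equiv.symm_apply_apply] at this
      exact absurd this (not_lt.2 hi)) s s' t)
  rw [← Matrix.rank_of_isUnit _ hunit, hLR]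
  calc (L * R).rank ≤ L.rank := Matrix.rank_mul_le_left _ _
    _ ≤ B.size m := by simpa using L.rank_le_card_width
    _ ≤ B.width := Finset.le_sup (Finset.mem_univ m)

end ROABP

/-! ### Refutations and the main theorem -/

/-- A refutation that is linear in the placeholder of `f` computes `1 / f` on the Boolean cube
after setting that placeholder to one and the others to zero. -/
theorem IsIPSLinPrimeRefutation.eval_mul_eval_eq_one {K σ : Type*} [CommRing K]
    {f : MvPolynomial σ K} {C : MvPolynomial (IPSVar σ Unit) K}
    (hC : IsIPSLinPrimeRefutation (fun _ => f) C) {a : σ → K} (ha : IsBooleanPoint a)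
    (c : K → IPSVar σ Unit → K) (horig : ∀ x i, c x (.orig i) = a i)
    (heqn : ∀ x j, c x (.eqn j) = x) (hbool : ∀ x i, c x (.bool i) = 0) :
    MvPolynomial.eval (c 1) C * MvPolynomial.eval a f = 1 := by
  classical
  obtain ⟨⟨h0, h1⟩, hdeg⟩ := hC
  have hlin : ∀ x, MvPolynomial.eval (c x) C =
      MvPolynomial.eval (c 0) C + x * (MvPolynomial.eval (c 1) C - MvPolynomial.eval (c 0) C) := by
    intro x
    simp only [MvPolynomial.eval_eq, ← Finset.sum_sub_distrib, ← Finset.sum_add_distrib,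
      Finset.mul_sum]
    refine Finset.sum_congr rfl fun d hd => ?_
    have hd1 : d (.eqn ()) ≤ 1 := MvPolynomial.degreeOf_le_iff.1 (hdeg ()) d hd
    have hsplit : ∀ y, ∏ i ∈ d.support, c y i ^ d i =
        y ^ d (.eqn ()) * ∏ i ∈ d.support.erase (.eqn ()), c 0 i ^ d i := by
      intro y
      have hrest : ∏ i ∈ d.support.erase (.eqn ()), c y i ^ d i =
          ∏ i ∈ d.support.erase (.eqn ()), c 0 i ^ d i := by
        refine Finset.prod_congr rfl fun i hi => ?_
        rcases i with i | i | i
        · rw [horig, horig]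
        · exact absurd rfl (Finset.ne_of_mem_erase hi)
        · rw [hbool, hbool]
      rw [← hrest]
      by_cases hmem : IPSVar.eqn () ∈ d.support
      · rw [← Finset.mul_prod_erase _ _ hmem, heqn]
      · rw [Finset.erase_eq_of_notMem hmem, Finsupp.notMem_support_iff.1 hmem, pow_zero, one_mul]
    rw [hsplit x, hsplit 0, hsplit 1]
    interval_cases d (.eqn ()) <;> simp <;> ring
  have hz : (fun i => MvPolynomial.aeval a (IPSVar.substZero i : MvPolynomial σ K)) = c 0 := by
    funext i
    rcases i with i | i | i <;> simp [IPSVar.substZero, horig, heqn, hbool]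
  have hs : (fun i => MvPolynomial.aeval a (IPSVar.substAxioms (fun _ => f) i)) =
      c (MvPolynomial.eval a f) := by
    funext i
    rcases i with i | i | i
    · simp [IPSVar.substAxioms, horig]
    · simp [IPSVar.substAxioms, heqn]
    · rcases ha i with h | h <;> simp [IPSVar.substAxioms, hbool, h]
  have e0 : MvPolynomial.eval (c 0) C = 0 := by
    have := congrArg (MvPolynomial.eval a) h0
    rw [map_zero, ← MvPolynomial.coe_aeval_eq_eval, RingHom.coe_coe, MvPolynomial.aeval_bind₁,
      hz] at this
    rwa [← MvPolynomial.coe_aeval_eq_eval, RingHom.coe_coe]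
  have e1 : MvPolynomial.eval (c (MvPolynomial.eval a f)) C = 1 := by
    have := congrArg (MvPolynomial.eval a) h1
    rw [map_one, ← MvPolynomial.coe_aeval_eq_eval, RingHom.coe_coe, MvPolynomial.aeval_bind₁,
      hs] at this
    rwa [← MvPolynomial.coe_aeval_eq_eval, RingHom.coe_coe]
  rw [hlin, e0] at e1
  linear_combination e1

/-- The Boolean point with coordinates the indicators of `S` and `T`. -/
def indicatorPoint (K : Type*) [Zero K] [One K] {ι κ : Type*} [DecidableEq ι] [DecidableEq κ]
    (S : Finset ι) (T : Finset κ) : ι ⊕ κ → K :=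
  Sum.elim (fun i => if i ∈ S then 1 else 0) (fun i => if i ∈ T then 1 else 0)

theorem isBooleanPoint_indicatorPoint {K ι κ : Type*} [Zero K] [One K] [DecidableEq ι]
    [DecidableEq κ] (S : Finset ι) (T : Finset κ) : IsBooleanPoint (indicatorPoint K S T) := by
  rintro (i | i) <;> simp only [indicatorPoint, Sum.elim_inl, Sum.elim_inr] <;> split_ifs <;> simp

theorem eval_liftedSubsetSum {K : Type*} [CommRing K] {n : ℕ} (α : Fin n → K) (β : K)
    (a : Fin n ⊕ Fin n → K) : MvPolynomial.eval a (liftedSubsetSum α β) =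
      ∑ i, α i * a (Sum.inl i) * a (Sum.inr i) - β := by
  simp [liftedSubsetSum]

theorem eval_indicatorPoint_liftedSubsetSum {K : Type*} [CommRing K] {n : ℕ} (α : Fin n → K)
    (β : K) (S T : Finset (Fin n)) :
    MvPolynomial.eval (indicatorPoint K S T) (liftedSubsetSum α β) = ∑ i ∈ S ∩ T, α i - β := by
  rw [eval_liftedSubsetSum, ← Finset.univ_inter (S ∩ T), ← Finset.sum_ite_mem]
  refine congrArg (· - β) (Finset.sum_congr rfl fun i _ => ?_)
  by_cases hS : i ∈ S <;> by_cases hT : i ∈ T <;> simp [indicatorPoint, hS, hT]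

theorem mainTheorem2 (n p k : ℕ) (hp : p.Prime) (hk : 2 ^ (2 * n) < p ^ k)
    {K : Type*} [Field K] (hK : Nat.card K = p ^ (2 * k))
    (F : Subfield K) (hF : Nat.card F = p ^ k) :
    (∃ β : K, β ∉ F) ∧
    ∀ β : K, β ∉ F → ∃ α : Fin n → F,
      (∀ a : Fin n ⊕ Fin n → K, IsBooleanPoint a →
        MvPolynomial.eval a (liftedSubsetSum (fun i => (α i : K)) β) ≠ 0) ∧
      (∀ g : MvPolynomial (Fin n ⊕ Fin n) K,
        (∀ a : Fin n ⊕ Fin n → K, IsBooleanPoint a →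
          MvPolynomial.eval a g =
            1 / MvPolynomial.eval a (liftedSubsetSum (fun i => (α i : K)) β)) →
        ∀ B : ROABP K (Fin n ⊕ Fin n), B.poly = g →
          B.ReadsBefore (Sum.inl : Fin n → Fin n ⊕ Fin n) (Sum.inr : Fin n → Fin n ⊕ Fin n) →
          2 ^ n ≤ B.width) ∧
      (∀ B : ROABP K (IPSVar (Fin n ⊕ Fin n) Unit),
        IsIPSLinPrimeRefutation (fun _ : Unit => liftedSubsetSum (fun i => (α i : K)) β) B.poly →
          B.ReadsBefore (fun i : Fin n => IPSVar.orig (Sum.inl i))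
            (fun j : Fin n => IPSVar.orig (Sum.inr j)) →
          2 ^ n ≤ B.width) := by
  classical
  have hk0 : k ≠ 0 := by
    rintro rfl
    simp at hk
  refine ⟨?_, fun β hβ => ?_⟩
  -- If `F` were all of `K`, then `k = 2 * k`, contradicting `k ≠ 0`.
  · by_contra! h
    have htop : F = ⊤ := eq_top_iff.2 fun x _ => h x
    have hcard : Nat.card F = Nat.card K := by
      rw [htop]
      exact Nat.card_congr Subfield.topEquiv.toEquiv
    rw [hF, hK] at hcard
    have := Nat.pow_right_injective hp.two_le hcard
    lia
  obtain ⟨α, hα⟩ := exists_forall_alternating_sum_ne_zero F hβ (Finset.univ : Finset (Fin n))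
    (by rw [hF, Finset.card_univ, Fintype.card_fin]; exact hk)
  have hunit := isUnit_intersection_matrix (fun W : Finset (Fin n) => 1 / (∑ i ∈ W, (α i : K) - β))
    fun U => hα U (Finset.subset_univ U)
  have hcard : Fintype.card (Finset (Fin n)) = 2 ^ n := by simp
  have hne : ∀ a : Fin n ⊕ Fin n → K, IsBooleanPoint a →
      MvPolynomial.eval a (liftedSubsetSum (fun i => (α i : K)) β) ≠ 0 := by
    intro a ha h
    rw [eval_liftedSubsetSum, sub_eq_zero] at h
    have hmem : ∀ i, a i ∈ F := fun i => by
      rcases ha i with h | h <;> rw [h]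
      exacts [F.zero_mem, F.one_mem]
    exact hβ (h ▸ F.sum_mem fun i _ => F.mul_mem (F.mul_mem (α i).2 (hmem _)) (hmem _))
  refine ⟨α, hne, ?_, ?_⟩
  · rintro g hg B rfl hB
    rw [← hcard]
    refine B.card_le_width_of_isUnit hB (indicatorPoint K) ?_ ?_ ?_
    · rintro (i | i) hi s s' t
      · exact absurd ⟨i, rfl⟩ hi
      · rfl
    · rintro (i | i) hi s t t'
      · rfl
      · exact absurd ⟨i, rfl⟩ hi
    · convert hunit using 2
      ext S T
      rw [hg _ (isBooleanPoint_indicatorPoint S T), eval_indicatorPoint_liftedSubsetSum]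
  · intro B hC hB
    rw [← hcard]
    let pt : K → Finset (Fin n) → Finset (Fin n) → IPSVar (Fin n ⊕ Fin n) Unit → K :=
      fun x S T i => match i with
        | .orig i => indicatorPoint K S T i
        | .eqn _ => x
        | .bool _ => 0
    refine B.card_le_width_of_isUnit hB (pt 1) ?_ ?_ ?_
    · rintro ((i | i) | i | i) hi s s' t
      · exact absurd ⟨i, rfl⟩ hi
      all_goals rfl
    · rintro ((i | i) | i | i) hi s t t'
      · rfl
      · exact absurd ⟨i, rfl⟩ hi
      all_goals rfl
    · convert hunit using 2
      ext S T
      rw [← eval_indicatorPoint_liftedSubsetSum]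
      have hST := isBooleanPoint_indicatorPoint (K := K) S T
      exact eq_one_div_of_mul_eq_one_left (hC.eval_mul_eval_eq_one hST (fun x => pt x S T)
        (fun _ _ => rfl) (fun _ _ => rfl) (fun _ _ => rfl))
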